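/- For $t\in\mathbb{Q}$ let $X^{(2,t)}$ be the double cover of $\mathbf{P}^2_{\mathbb{Q}}$ (with coordinates $x,y,z$), branched over six lines, that is given in the weighted projective space $\mathbf{P}(1,1,1,3)$ by $$w^2=f_t(x,y,z),$$ where $$\begin{aligned} f_t := {}& \left[(\tfrac18t^2-\tfrac12t+\tfrac14)y^2+(t^2-2t+2)yz+(t^2-4t+2)z^2\right]\\ &\cdot\left[(\tfrac18t^2+\tfrac12t+\tfrac14)x^2+(t^2+2t+2)xz+(t^2+4t+2)z^2\right]\cdot\left[2x^2+(t^2+2)xy+t^2y^2\right];\end{aligned}$$ its minimal desingularization is a K3 surface. For an odd prime $p$, the reduction $X^{(2,t)}_p$ of $X^{(2,t)}$ modulo $p$ is the double cover $w^2=\overline{F}(x,y,z)$ of $\mathbf{P}^2_{\mathbb{F}_p}$, where $F\in\mathbb{Z}[x,y,z]$ is of the form $F=c^2f_t$ with $c\in\mathbb{Q}^\times$, and its reduction $\overline{F}:=F \bmod p$ is nonzero. Then, for every $t\in\mathbb{Q}$ and every prime $p\equiv 3,5\pmod 8$, such an $F$ exists and, for every choice of $F$, $$\#X^{(2,t)}_p(\mathbb{F}_p)\equiv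 1\pmod p .$$ -/

import Mathlib

/-!
The double cover `w ^ 2 = f(x, y, z)` of the projective plane, for a ternary sextic form `f`, lives in
the weighted projective space `P(1, 1, 1, 3)`.  Variables `0, 1, 2` stand for `x, y, z`.
-/

namespace RealMult

open MvPolynomial

/-- Nonzero vectors `((x, y, z), w)` over `k` with `w ^ 2 = f(x, y, z)`. -/
def ConePoint {k : Type*} [Field k] (f : MvPolynomial (Fin 3) k) : Type _ :=
  {P : (Fin 3 → k) × k // P ≠ 0 ∧ P.2 ^ 2 = eval P.1 f}

/-- Two such vectors give the same point of `P(1, 1, 1, 3)` if they differ by the action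
`c • (x, y, z, w) = (c x, c y, c z, c ^ 3 w)` of a nonzero scalar `c`. -/
def coneSetoid {k : Type*} [Field k] (f : MvPolynomial (Fin 3) k) : Setoid (ConePoint f) where
  r P Q := ∃ c : kˣ, (∀ i, Q.1.1 i = c * P.1.1 i) ∧ Q.1.2 = (c : k) ^ 3 * P.1.2
  iseqv :=
    { refl := fun P => ⟨1, by simp, by simp⟩
      symm := by
        rintro P Q ⟨c, h1, h2⟩
        refine ⟨c⁻¹, fun i => ?_, ?_⟩
        · rw [h1 i, Units.inv_mul_cancel_left]
        · rw [h2, ← mul_assoc, ← mul_pow, Units.inv_mul, one_pow, one_mul]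
      trans := by
        rintro P Q R ⟨c, h1, h2⟩ ⟨d, h3, h4⟩
        refine ⟨d * c, fun i => ?_, ?_⟩
        · rw [h3 i, h1 i, Units.val_mul, mul_assoc]
        · rw [h4, h2, Units.val_mul, mul_pow, mul_assoc] }

/-- The `k`-rational points of the double cover `w ^ 2 = f(x, y, z)` of the projective plane
(`f` a form of degree six). -/
def DoubleCover {k : Type*} [Field k] (f : MvPolynomial (Fin 3) k) : Type _ :=
  Quotient (coneSetoid f)

/-- `F` is the right hand side of an integral equation `w ^ 2 = F(x, y, z)` of the double cover
`w ^ 2 = f(x, y, z)` over the rationals (so `F = c ^ 2 f` with `c ≠ 0`, the change of coordinate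
being `w ↦ c w`) which is primitive at `p`.  For odd `p`, the reduction modulo `p` of the double
cover is then `w ^ 2 = (F mod p)(x, y, z)`. -/
def IsModelAt (p : ℕ) (f : MvPolynomial (Fin 3) ℚ) (F : MvPolynomial (Fin 3) ℤ) : Prop :=
  (∃ c : ℚ, c ≠ 0 ∧ map (Int.castRingHom ℚ) F = C (c ^ 2) * f) ∧
    map (Int.castRingHom (ZMod p)) F ≠ 0

/-- The form `q₁(y, z)`. -/
noncomputable def q₁ (t : ℚ) : MvPolynomial (Fin 3) ℚ :=
  C (1 / 8 * t ^ 2 - 1 / 2 * t + 1 / 4) * X 1 ^ 2 + C (t ^ 2 - 2 * t + 2) * (X 1 * X 2)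
    + C (t ^ 2 - 4 * t + 2) * X 2 ^ 2

/-- The form `q₂(x, z)`. -/
noncomputable def q₂ (t : ℚ) : MvPolynomial (Fin 3) ℚ :=
  C (1 / 8 * t ^ 2 + 1 / 2 * t + 1 / 4) * X 0 ^ 2 + C (t ^ 2 + 2 * t + 2) * (X 0 * X 2)
    + C (t ^ 2 + 4 * t + 2) * X 2 ^ 2

/-- The form `q₃(x, y)`. -/
noncomputable def q₃ (t : ℚ) : MvPolynomial (Fin 3) ℚ :=
  C 2 * X 0 ^ 2 + C (t ^ 2 + 2) * (X 0 * X 1) + C (t ^ 2) * X 1 ^ 2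

/-- The branch sextic of the surface `X^(2,t) : w ^ 2 = q₁(y, z) q₂(x, z) q₃(x, y)`. -/
noncomputable def branchSextic (t : ℚ) : MvPolynomial (Fin 3) ℚ :=
  q₁ t * q₂ t * q₃ t

end RealMult

/-! All character sums take values in the field `K` with `q` elements, where `q = 0`. Counting the
cone over the surface gives `N * (q - 1) = S - 1` in `K`, with `S` the sum of `chi` of the sextic
over `K ^ 3`, so the claim is `S = 0`.

A sum `∑ chi f * chi g` of two quadratics is computed from the zeros of `f - X g`, hence from the
discriminant of the pencil. Doing this in `z` (`sum_chi_two_quadrics`) and then in `(x, y)`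
(`sum_chi_two_binary_forms`) turns `S` into `∑ X, chi r * E r`, up to sign. Here `r = X / (X ^ 2 - 6
X + 1)` and `E` is `ellipticSum`, so the fibre depends on `X` only through `r`.

The map `X ↦ r` has degree two and discriminant `(4 r + 1) (8 r + 1)`. This leaves `∑ chi r * E r`,
which vanishes by summing over `r` first, and its twist by `chi ((4 r + 1) (8 r + 1))`. A 2-isogeny
relates the fibres at `r` and `-r - 1/4`, and under this involution the twisted sum is multiplied by
`chi 2`. For `p ≡ 3, 5 (mod 8)` this is `-1`, so the sum is zero. Non-squareness of 2 also makes `a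
^ 2 - 2 b ^ 2` anisotropic, which excludes the degenerate cases. -/

namespace RealMult

/-! ### Sums of quadratic characters, as elements of the field -/

section CharacterSums

variable {K : Type*} [Field K] [Fintype K]

theorem sum_const (a : K) : ∑ _x : K, a = 0 := by
  simp [Finset.card_univ]

theorem sum_comp_affine {b : K} (hb : b ≠ 0) (a : K) (f : K → K) :
    ∑ x : K, f (b * x + a) = ∑ x : K, f x :=
  Fintype.sum_equiv ((Equiv.mulLeft₀ b hb).trans (Equiv.addRight a)) _ _ fun _ => rfl

variable [DecidableEq K]

/-- The quadratic character of a finite field, with values in the field itself. -/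
def chi (x : K) : K := ((quadraticChar K x : ℤ) : K)

theorem chi_zero : chi (0 : K) = 0 := by simp [chi]

theorem chi_mul (x y : K) : chi (x * y) = chi x * chi y := by
  unfold chi
  rw [map_mul, Int.cast_mul]

theorem chi_mul_self {x : K} (hx : x ≠ 0) : chi x * chi x = 1 := by
  have h := quadraticChar_sq_one hx
  rw [sq] at h
  unfold chi
  exact_mod_cast congrArg (Int.cast : ℤ → K) h

theorem chi_sq {x : K} (hx : x ≠ 0) : chi (x ^ 2) = 1 := by
  rw [sq, chi_mul, chi_mul_self hx]

theorem chi_sq_mul {x : K} (hx : x ≠ 0) (y : K) : chi (x ^ 2 * y) = chi y := by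
  rw [chi_mul, chi_sq hx, one_mul]

theorem sum_chi (hK : ringChar K ≠ 2) : ∑ x : K, chi x = 0 := by
  have h := quadraticChar_sum_zero hK
  unfold chi
  exact_mod_cast congrArg (Int.cast : ℤ → K) h

theorem sum_ite_sq_eq (hK : ringChar K ≠ 2) (a : K) :
    ∑ x : K, (if x ^ 2 = a then (1 : K) else 0) = 1 + chi a := by
  have h := quadraticChar_card_sqrts hK a
  rw [Finset.sum_boole]
  have e : (Finset.univ.filter fun x : K => x ^ 2 = a) = {x : K | x ^ 2 = a}.toFinset := by
    ext; simp
  rw [e, add_comm]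
  unfold chi
  exact_mod_cast congrArg (Int.cast : ℤ → K) h

theorem sum_ite_eq_mul (f : K → K) (a : K) {b : K} (hb : b ≠ 0) :
    ∑ X : K, f X * (if a = X * b then (1 : K) else 0) = f (a / b) := by
  rw [Finset.sum_eq_single (a / b)]
  · rw [if_pos (by field_simp), mul_one]
  · intro X _ hX
    rw [if_neg, mul_zero]
    rintro rfl
    exact hX (by field_simp)
  · simp

theorem sum_chi_ite (hK : ringChar K ≠ 2) (a b : K) :
    ∑ X : K, chi X * (if a = X * b then (1 : K) else 0) = chi a * chi b := by
  by_cases hb : b = 0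
  · subst hb
    by_cases ha : a = 0
    · simp [ha, chi_zero, sum_chi hK]
    · simp [ha, chi_zero]
  · rw [sum_ite_eq_mul chi a hb, ← chi_mul, show a / b = (b⁻¹) ^ 2 * (a * b) by field_simp,
      chi_sq_mul (inv_ne_zero hb)]

/-- Sums of products of two characters, via the fibres of the quotient of the arguments. -/
theorem sum_chi_mul_chi (hK : ringChar K ≠ 2) {ι : Type*} [Fintype ι] (f g : ι → K) :
    ∑ i, chi (f i) * chi (g i)
      = ∑ X : K, chi X * ∑ i, (if f i - X * g i = 0 then (1 : K) else 0) := by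
  simp_rw [sub_eq_zero, Finset.mul_sum]
  rw [Finset.sum_comm]
  exact Finset.sum_congr rfl fun i _ => (sum_chi_ite hK _ _).symm

/-- The formula covers degenerate coefficients too: the zero polynomial has `q = 0` roots in `K`,
and for `a = 0` the last term removes the root at infinity. -/
theorem sum_ite_quadratic (hK : ringChar K ≠ 2) (a b c : K) :
    ∑ z : K, (if a * z ^ 2 + b * z + c = 0 then (1 : K) else 0)
      = 1 + chi (b ^ 2 - 4 * a * c) - (if a = 0 then 1 else 0) := by
  have h2 := Ring.two_ne_zero hK
  by_cases ha : a = 0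
  · subst ha
    by_cases hb : b = 0
    · subst hb
      by_cases hc : c = 0
      · simp [hc, chi_zero]
      · simp [hc, chi_zero]
    · have h : ∀ z : K, (0 * z ^ 2 + b * z + c = 0) ↔ z = -c / b := by
        intro z
        rw [eq_div_iff hb]
        constructor <;> intro h <;> linear_combination h
      simp only [h]
      simp [chi_sq hb]
  · have h4 : 4 * a ≠ 0 := by
      rw [show (4 : K) = 2 * 2 by norm_num]
      exact mul_ne_zero (mul_ne_zero h2 h2) ha
    have h : ∀ z : K, (a * z ^ 2 + b * z + c = 0) ↔ (2 * a * z + b) ^ 2 = b ^ 2 - 4 * a * c := by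
      intro z
      rw [← sub_eq_zero (b := b ^ 2 - 4 * a * c), show (2 * a * z + b) ^ 2 - (b ^ 2 - 4 * a * c)
        = 4 * a * (a * z ^ 2 + b * z + c) by ring, mul_eq_zero, or_iff_right h4]
    simp only [h]
    rw [sum_comp_affine (mul_ne_zero h2 ha) b fun x =>
      if x ^ 2 = b ^ 2 - 4 * a * c then (1 : K) else 0, sum_ite_sq_eq hK, if_neg ha, sub_zero]

theorem sum_chi_sq_mul (d : K) : ∑ y : K, chi (y ^ 2 * d) = -chi d := by
  have h : ∀ y : K, chi (y ^ 2 * d) = chi d - (if y = 0 then chi d else 0) := by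
    intro y
    by_cases hy : y = 0
    · simp [hy, chi_zero]
    · simp [hy, chi_sq_mul hy]
  simp only [h, Finset.sum_sub_distrib, sum_const]
  simp

theorem sum_ite_binary_form (hK : ringChar K ≠ 2) (a b c : K) :
    ∑ v : K × K, (if a * v.1 ^ 2 + b * v.1 * v.2 + c * v.2 ^ 2 = 0 then (1 : K) else 0)
      = -chi (b ^ 2 - 4 * a * c) := by
  rw [Fintype.sum_prod_type_right]
  have h : ∀ y : K, ∑ x : K, (if a * x ^ 2 + b * x * y + c * y ^ 2 = 0 then (1 : K) else 0)
      = 1 + chi (y ^ 2 * (b ^ 2 - 4 * a * c)) - (if a = 0 then 1 else 0) := by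
    intro y
    have := sum_ite_quadratic hK a (b * y) (c * y ^ 2)
    rw [show y ^ 2 * (b ^ 2 - 4 * a * c) = (b * y) ^ 2 - 4 * a * (c * y ^ 2) by ring, ← this]
    simp only [mul_right_comm]
  simp only [h, Finset.sum_sub_distrib, Finset.sum_add_distrib, sum_const, sum_chi_sq_mul]
  ring

theorem sum_chi_affine (hK : ringChar K ≠ 2) (a b : K) : ∑ x : K, chi (b * x + a) = 0 := by
  by_cases hb : b = 0
  · simp [hb]
  · rw [sum_comp_affine hb a chi, sum_chi hK]

/-- Dividing by `x ^ 2` makes the argument affine in `x⁻¹`. The case `b = 0` is no exception, since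
`q - 1 = -1` in `K`. -/
theorem sum_chi_mul_chi_affine (hK : ringChar K ≠ 2) (a b : K) :
    ∑ x : K, chi x * chi (a * x + b) = -chi a := by
  have h : ∀ x : K, chi x * chi (a * x + b)
      = chi (b * x⁻¹ + a) - (if x = 0 then chi a else 0) := by
    intro x
    by_cases hx : x = 0
    · simp [hx, chi_zero]
    · rw [if_neg hx, sub_zero, ← chi_mul, show x * (a * x + b) = x ^ 2 * (b * x⁻¹ + a) by
        field_simp; ring, chi_sq_mul hx]
  simp only [h, Finset.sum_sub_distrib]
  rw [Fintype.sum_equiv (Equiv.inv K) (fun x => chi (b * x⁻¹ + a)) (fun x => chi (b * x + a))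
    fun _ => rfl, sum_chi_affine hK]
  simp

/-- The character sums of the curves `w ^ 2 = Y (Y ^ 2 + a Y + b)` and
`w ^ 2 = Y (Y ^ 2 - 2 a Y + a ^ 2 - 4 b)`, which are related by a 2-isogeny, agree. -/
theorem sum_chi_two_isogeny (hK : ringChar K ≠ 2) (a b : K) :
    ∑ Y : K, chi Y * chi (Y ^ 2 + a * Y + b)
      = ∑ Y : K, chi Y * chi (Y ^ 2 - 2 * a * Y + (a ^ 2 - 4 * b)) := by
  -- The isogeny has `X = (Y ^ 2 + a Y + b) / Y`; its fibres are cut out by a quadratic in `Y` whose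
  -- discriminant is the other cubic's quadratic factor, in `X`.
  have h := sum_chi_mul_chi hK (fun Y : K => Y ^ 2 + a * Y + b) (fun Y => Y)
  have h' : ∀ X : K, ∑ Y : K, (if Y ^ 2 + a * Y + b - X * Y = 0 then (1 : K) else 0)
      = 1 + chi (X ^ 2 - 2 * a * X + (a ^ 2 - 4 * b)) := by
    intro X
    have := sum_ite_quadratic hK 1 (a - X) b
    rw [if_neg one_ne_zero, sub_zero, show (a - X) ^ 2 - 4 * 1 * b
      = X ^ 2 - 2 * a * X + (a ^ 2 - 4 * b) by ring] at this
    rw [← this]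
    refine Finset.sum_congr rfl fun Y _ => ?_
    rw [show Y ^ 2 + a * Y + b - X * Y = 1 * Y ^ 2 + (a - X) * Y + b by ring]
  simp only [h', mul_add, mul_one, Finset.sum_add_distrib, sum_chi hK, zero_add] at h
  rw [← h]
  exact Finset.sum_congr rfl fun Y _ => mul_comm _ _

end CharacterSums

/-! ### The character sum of the branch sextic -/

section BranchSextic

variable {K : Type*} [Field K] [Fintype K] [DecidableEq K]

/-- The character sum of the curve `w ^ 2 = Y (Y ^ 2 - 2 e Y + n + 4 c r)`. -/
def ellipticSum (e n c r : K) : K := ∑ Y : K, chi Y * chi (Y ^ 2 - 2 * e * Y + (n + 4 * c * r))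

/-- After the 2-isogeny, `Y ↦ -2 Y` restores the middle coefficient `-2 e`. The constant becomes `e
^ 2 - n - 4 c r`, which by `h` is `n + 4 c (-r - 1 / 4)`. -/
theorem ellipticSum_symm (hK : ringChar K ≠ 2) {e n c : K} (h : e ^ 2 - n = n - c) (r : K) :
    ellipticSum e n c (-r - 1 / 4) = chi (-2) * ellipticSum e n c r := by
  have h2 : (2 : K) ≠ 0 := Ring.two_ne_zero hK
  have h4 : (4 : K) ≠ 0 := by
    rw [show (4 : K) = 2 * 2 by norm_num]
    exact mul_ne_zero h2 h2
  unfold ellipticSum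
  have h1 := sum_chi_two_isogeny hK (-2 * e) (n + 4 * c * r)
  simp only [show ∀ Y : K, Y ^ 2 - 2 * e * Y = Y ^ 2 + -2 * e * Y from fun Y => by ring]
  rw [h1, ← sum_comp_affine (neg_ne_zero.mpr h2) 0 fun Y => chi Y * chi (Y ^ 2 - _ * Y + _),
    Finset.mul_sum]
  refine Finset.sum_congr rfl fun Y _ => ?_
  rw [add_zero, ← mul_assoc, ← chi_mul, ← chi_mul, ← chi_mul, ← chi_sq_mul h4 (Y * _)]
  congr 1
  field_simp
  linear_combination -16 * Y * h

/-- For fixed `Y` the quadratic factor is affine in `r`, so the inner sum is a constant times `chi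
Y`. -/
theorem sum_chi_mul_ellipticSum (hK : ringChar K ≠ 2) (e n c : K) :
    ∑ r : K, chi r * ellipticSum e n c r = 0 := by
  unfold ellipticSum
  simp_rw [Finset.mul_sum]
  rw [Finset.sum_comm]
  have h : ∀ Y : K, ∑ r : K, chi r * (chi Y * chi (Y ^ 2 - 2 * e * Y + (n + 4 * c * r)))
      = -chi (4 * c) * chi Y := by
    intro Y
    rw [← sum_chi_mul_chi_affine hK (4 * c) (Y ^ 2 - 2 * e * Y + n), Finset.sum_mul]
    refine Finset.sum_congr rfl fun r _ => ?_
    rw [show Y ^ 2 - 2 * e * Y + (n + 4 * c * r) = 4 * c * r + (Y ^ 2 - 2 * e * Y + n) by ring]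
    ring
  simp only [h]
  rw [← Finset.mul_sum, sum_chi hK, mul_zero]

theorem sq_ne_two_mul_sq (hK : ringChar K ≠ 2) (h2 : chi (2 : K) = -1) {a b : K}
    (h : a ≠ 0 ∨ b ≠ 0) : a ^ 2 - 2 * b ^ 2 ≠ 0 := by
  intro h0
  have hb : b ≠ 0 := by
    rintro rfl
    simp_all
  have e : a ^ 2 = b ^ 2 * 2 := by linear_combination h0
  have ha : a ≠ 0 := by
    rintro rfl
    have : b ^ 2 * 2 = 0 := by rw [← e]; ring
    exact mul_ne_zero (pow_ne_zero 2 hb) (Ring.two_ne_zero hK) this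
  have h3 := congrArg chi e
  rw [chi_sq ha, chi_sq_mul hb, h2] at h3
  exact Ring.two_ne_zero hK (by linear_combination h3)

theorem sum_chi_mul_chi_mul_ellipticSum (hK : ringChar K ≠ 2) (h2 : chi (2 : K) = -1)
    {e n c : K} (h : e ^ 2 - n = n - c) :
    ∑ r : K, chi r * ellipticSum e n c r * chi ((4 * r + 1) * (8 * r + 1)) = 0 := by
  have h20 : (2 : K) ≠ 0 := Ring.two_ne_zero hK
  have h4 : (4 : K) ≠ 0 := by
    rw [show (4 : K) = 2 * 2 by norm_num]
    exact mul_ne_zero h20 h20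
  set T := ∑ r : K, chi r * ellipticSum e n c r * chi ((4 * r + 1) * (8 * r + 1)) with hT
  have hneg : T = -T := by
    conv_lhs => rw [hT, ← sum_comp_affine (neg_ne_zero.mpr one_ne_zero) (-1 / 4)]
    rw [hT, ← Finset.sum_neg_distrib]
    refine Finset.sum_congr rfl fun r _ => ?_
    rw [show -1 * r + -1 / 4 = -r - 1 / 4 by ring, ellipticSum_symm hK h]
    have h5 : chi (-r - 1 / 4) * chi (-2) * chi ((4 * (-r - 1 / 4) + 1) * (8 * (-r - 1 / 4) + 1))
        = -(chi r * chi ((4 * r + 1) * (8 * r + 1))) := by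
      rw [← chi_mul, ← chi_mul, ← chi_mul, show (-r - 1 / 4) * -2 *
        ((4 * (-r - 1 / 4) + 1) * (8 * (-r - 1 / 4) + 1))
          = 2 * (r * ((4 * r + 1) * (8 * r + 1))) by field_simp; ring, chi_mul 2, h2]
      ring
    linear_combination ellipticSum e n c r * h5
  have : 2 * T = 0 := by linear_combination hneg
  exact (mul_eq_zero.mp this).resolve_left h20

theorem sum_ellipticSum_pencil (hK : ringChar K ≠ 2) (h2 : chi (2 : K) = -1)
    {e n c : K} (h : e ^ 2 - n = n - c) :
    ∑ X : K, chi (X / (X ^ 2 - 6 * X + 1)) * ellipticSum e n c (X / (X ^ 2 - 6 * X + 1)) = 0 := by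
  have h20 : (2 : K) ≠ 0 := Ring.two_ne_zero hK
  have hw : ∀ X : K, X ^ 2 - 6 * X + 1 ≠ 0 := by
    intro X hX
    refine sq_ne_two_mul_sq hK h2 (a := X - 3) (b := 2) (Or.inr h20) ?_
    linear_combination hX
  have h1 : ∀ X : K, chi (X / (X ^ 2 - 6 * X + 1)) * ellipticSum e n c (X / (X ^ 2 - 6 * X + 1))
      = ∑ r : K, chi r * ellipticSum e n c r
        * (if r * X ^ 2 + -(6 * r + 1) * X + r = 0 then (1 : K) else 0) := by
    intro X
    rw [← sum_ite_eq_mul (fun r => chi r * ellipticSum e n c r) X (hw X)]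
    refine Finset.sum_congr rfl fun r _ => ?_
    congr 2
    rw [eq_iff_iff]
    constructor <;> intro h <;> linear_combination -h
  simp only [h1]
  rw [Finset.sum_comm]
  have h3 : ∀ r : K, ∑ X : K, chi r * ellipticSum e n c r
        * (if r * X ^ 2 + -(6 * r + 1) * X + r = 0 then (1 : K) else 0)
      = chi r * ellipticSum e n c r
        + chi r * ellipticSum e n c r * chi ((4 * r + 1) * (8 * r + 1)) := by
    intro r
    by_cases hr : r = 0
    · simp [hr, chi_zero]
    · rw [← Finset.mul_sum, sum_ite_quadratic hK, if_neg hr, show (-(6 * r + 1)) ^ 2 - 4 * r * r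
        = (4 * r + 1) * (8 * r + 1) by ring]
      ring
  simp only [h3, Finset.sum_add_distrib]
  rw [sum_chi_mul_ellipticSum hK, sum_chi_mul_chi_mul_ellipticSum hK h2 h, add_zero]

/-- For `x y ≠ 0` this is the substitution `X ↦ X y / x`; the two sums agree for `x y = 0` too. -/
theorem sum_chi_pencil_twist (hK : ringChar K ≠ 2) (n m c x y : K) :
    ∑ X : K, chi X * chi (n * (y ^ 2 + X ^ 2 * x ^ 2) - m * X * x * y + c * X * (x ^ 2 + y ^ 2))
      = ∑ X : K, chi X *
        chi (c * X * x ^ 2 + (n * (1 + X ^ 2) - m * X) * x * y + c * X * y ^ 2) := by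
  have key : ∀ d : K, ∑ X : K, chi X * chi (d * X) = -chi d := by
    intro d
    simpa using sum_chi_mul_chi_affine hK d 0
  -- On the two axes both sides reduce to `-chi` of `c y ^ 2` or `c x ^ 2`.
  by_cases hx : x = 0
  · subst hx
    have h1 := sum_chi_mul_chi_affine hK (c * y ^ 2) (n * y ^ 2)
    have h2 := key (c * y ^ 2)
    rw [← h2] at h1
    convert h1 using 4 <;> ring
  by_cases hy : y = 0
  · subst hy
    have h1 : ∀ X : K, chi X * chi (n * (0 ^ 2 + X ^ 2 * x ^ 2) - m * X * x * 0
        + c * X * (x ^ 2 + 0 ^ 2))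
        = chi (n * x ^ 2 * X + c * x ^ 2) - (if X = 0 then chi (c * x ^ 2) else 0) := by
      intro X
      by_cases hX : X = 0
      · simp [hX, chi_zero]
      · rw [if_neg hX, sub_zero, ← chi_mul, ← chi_sq_mul hX (n * x ^ 2 * X + c * x ^ 2)]
        congr 1
        ring
    have h2 := key (c * x ^ 2)
    simp only [h1, Finset.sum_sub_distrib, sum_chi_affine hK]
    rw [Finset.sum_ite_eq' Finset.univ 0, if_pos (Finset.mem_univ _), zero_sub, ← h2]
    congr 1
    ext X
    congr 2
    ring
  · have hyx := div_ne_zero hy hx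
    rw [← sum_comp_affine hyx 0]
    refine Finset.sum_congr rfl fun X _ => ?_
    rw [← chi_mul, ← chi_mul, ← chi_sq_mul hyx (X * _)]
    congr 1
    field_simp
    ring

/-- This kills the contribution of the correction term `chi a₁ * chi a₂` in `sum_chi_two_quadrics`.
-/
theorem sum_chi_line_pair (hK : ringChar K ≠ 2) (u s : K) :
    ∑ v : K × K, chi ((2 * u * v.1 + s * v.2) * (v.1 + v.2)) = 0 := by
  rw [Fintype.sum_prod_type_right]
  have h : ∀ y : K, ∑ x : K, chi ((2 * u * x + s * y) * (x + y)) = -chi (2 * u) := by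
    intro y
    rw [← sum_chi_mul_chi_affine hK (2 * u) (s * y - 2 * u * y), ← sum_comp_affine one_ne_zero (-y)]
    refine Finset.sum_congr rfl fun x _ => ?_
    rw [← chi_mul]
    congr 1
    ring
  simp only [h, sum_const]

/-- The correction comes from the member of the pencil whose leading coefficient vanishes, that is,
from `z = ∞`. -/
theorem sum_chi_two_quadrics (hK : ringChar K ≠ 2) (a₁ b₁ c₁ a₂ b₂ c₂ : K) :
    ∑ z : K, chi (a₁ * z ^ 2 + b₁ * z + c₁) * chi (a₂ * z ^ 2 + b₂ * z + c₂)
      = ∑ X : K, chi X * chi ((b₁ - X * b₂) ^ 2 - 4 * (a₁ - X * a₂) * (c₁ - X * c₂))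
        - chi a₁ * chi a₂ := by
  rw [sum_chi_mul_chi hK, ← sum_chi_ite hK a₁ a₂]
  have h : ∀ X : K, chi X * ∑ z : K,
      (if a₁ * z ^ 2 + b₁ * z + c₁ - X * (a₂ * z ^ 2 + b₂ * z + c₂) = 0 then (1 : K) else 0)
      = chi X + chi X * chi ((b₁ - X * b₂) ^ 2 - 4 * (a₁ - X * a₂) * (c₁ - X * c₂))
        - chi X * (if a₁ = X * a₂ then 1 else 0) := by
    intro X
    have h' : ∀ z : K, a₁ * z ^ 2 + b₁ * z + c₁ - X * (a₂ * z ^ 2 + b₂ * z + c₂)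
        = (a₁ - X * a₂) * z ^ 2 + (b₁ - X * b₂) * z + (c₁ - X * c₂) := fun z => by ring
    simp only [h', sum_ite_quadratic hK, sub_eq_zero (a := a₁)]
    ring
  simp only [h, Finset.sum_sub_distrib, Finset.sum_add_distrib, sum_chi hK, zero_add]

theorem sum_chi_two_binary_forms (hK : ringChar K ≠ 2) (a₁ b₁ c₁ a₂ b₂ c₂ : K) :
    ∑ v : K × K, chi (a₁ * v.1 ^ 2 + b₁ * v.1 * v.2 + c₁ * v.2 ^ 2)
        * chi (a₂ * v.1 ^ 2 + b₂ * v.1 * v.2 + c₂ * v.2 ^ 2)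
      = -∑ X : K, chi X * chi ((b₁ - X * b₂) ^ 2 - 4 * (a₁ - X * a₂) * (c₁ - X * c₂)) := by
  rw [sum_chi_mul_chi hK, ← Finset.sum_neg_distrib]
  refine Finset.sum_congr rfl fun X _ => ?_
  have h : ∀ v : K × K, a₁ * v.1 ^ 2 + b₁ * v.1 * v.2 + c₁ * v.2 ^ 2
        - X * (a₂ * v.1 ^ 2 + b₂ * v.1 * v.2 + c₂ * v.2 ^ 2)
      = (a₁ - X * a₂) * v.1 ^ 2 + (b₁ - X * b₂) * v.1 * v.2 + (c₁ - X * c₂) * v.2 ^ 2 :=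
    fun v => by ring
  simp only [h, sum_ite_binary_form hK]
  ring

/-- The branch sextic, homogenized in the parameter `t = a / b` and cleared of denominators. -/
def sexticValue {R : Type*} [CommRing R] (a b x y z : R) : R :=
  ((a ^ 2 - 4 * a * b + 2 * b ^ 2) * y ^ 2 + 8 * (a ^ 2 - 2 * a * b + 2 * b ^ 2) * (y * z)
      + 8 * (a ^ 2 - 4 * a * b + 2 * b ^ 2) * z ^ 2)
    * ((a ^ 2 + 4 * a * b + 2 * b ^ 2) * x ^ 2 + 8 * (a ^ 2 + 2 * a * b + 2 * b ^ 2) * (x * z)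
      + 8 * (a ^ 2 + 4 * a * b + 2 * b ^ 2) * z ^ 2)
    * (2 * b ^ 2 * x ^ 2 + (a ^ 2 + 2 * b ^ 2) * (x * y) + a ^ 2 * y ^ 2)

theorem sum_chi_sexticValue (hK : ringChar K ≠ 2) (h2 : chi (2 : K) = -1) {a b : K}
    (hab : a ≠ 0 ∨ b ≠ 0) :
    ∑ v : K × K, ∑ z : K, chi (sexticValue a b v.1 v.2 z) = 0 := by
  have h20 : (2 : K) ≠ 0 := Ring.two_ne_zero hK
  set A := a ^ 2 - 4 * a * b + 2 * b ^ 2 with hA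
  set A' := a ^ 2 + 4 * a * b + 2 * b ^ 2 with hA'
  set B := a ^ 2 - 2 * a * b + 2 * b ^ 2 with hB
  set B' := a ^ 2 + 2 * a * b + 2 * b ^ 2 with hB'
  set l := a ^ 2 - 2 * b ^ 2 with hl
  set c := a ^ 4 - 12 * a ^ 2 * b ^ 2 + 4 * b ^ 4 with hc
  set m := 4 * (a ^ 4 + 4 * b ^ 4) with hm
  set e := a ^ 2 + 2 * b ^ 2 with he
  have hl0 : l ≠ 0 := sq_ne_two_mul_sq hK h2 hab
  -- the sum over `z`
  have hz : ∀ v : K × K, ∑ z : K, chi (sexticValue a b v.1 v.2 z)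
      = -(chi ((2 * b ^ 2 * v.1 + a ^ 2 * v.2) * (v.1 + v.2)) * ∑ X : K, chi X *
          chi (c * X * v.1 ^ 2 + (l ^ 2 * (1 + X ^ 2) - m * X) * v.1 * v.2 + c * X * v.2 ^ 2))
        - chi (8 * A) * chi (8 * A')
          * chi ((2 * b ^ 2 * v.1 + a ^ 2 * v.2) * (v.1 + v.2)) := by
    rintro ⟨x, y⟩
    dsimp only
    rw [← sum_chi_pencil_twist hK]
    have h1 := sum_chi_two_quadrics hK (8 * A) (8 * B * y) (A * y ^ 2) (8 * A') (8 * B' * x)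
      (A' * x ^ 2)
    -- The discriminant is 32 times the form on the right; `chi 32 = chi 2 = -1` gives the sign.
    have h3 : ∀ X : K, chi ((8 * B * y - X * (8 * B' * x)) ^ 2
          - 4 * (8 * A - X * (8 * A')) * (A * y ^ 2 - X * (A' * x ^ 2)))
        = -chi (l ^ 2 * (y ^ 2 + X ^ 2 * x ^ 2) - m * X * x * y + c * X * (x ^ 2 + y ^ 2)) := by
      intro X
      rw [← neg_one_mul (chi _), ← h2, ← chi_mul,
        ← chi_sq_mul (pow_ne_zero 2 h20) (2 * _)]
      congr 1
      rw [hA, hA', hB, hB', hl, hc, hm]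
      ring
    simp only [h3, mul_neg, Finset.sum_neg_distrib] at h1
    have h4 : ∀ z : K, chi (sexticValue a b x y z)
        = chi ((2 * b ^ 2 * x + a ^ 2 * y) * (x + y)) *
          (chi (8 * A * z ^ 2 + 8 * B * y * z + A * y ^ 2)
            * chi (8 * A' * z ^ 2 + 8 * B' * x * z + A' * x ^ 2)) := by
      intro z
      rw [← chi_mul, ← chi_mul]
      congr 1
      unfold sexticValue
      ring
    simp only [h4]
    rw [← Finset.mul_sum, h1]
    ring
  simp only [hz, Finset.sum_sub_distrib, Finset.sum_neg_distrib]
  rw [← Finset.mul_sum, sum_chi_line_pair hK, mul_zero, sub_zero, neg_eq_zero]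
  simp_rw [Finset.mul_sum]
  rw [Finset.sum_comm]
  have hX : ∀ X : K, ∑ v : K × K, chi ((2 * b ^ 2 * v.1 + a ^ 2 * v.2) * (v.1 + v.2)) * (chi X *
          chi (c * X * v.1 ^ 2 + (l ^ 2 * (1 + X ^ 2) - m * X) * v.1 * v.2 + c * X * v.2 ^ 2))
      = -(chi (X / (X ^ 2 - 6 * X + 1))
        * ellipticSum e (l ^ 2) c (X / (X ^ 2 - 6 * X + 1))) := by
    intro X
    have hw : X ^ 2 - 6 * X + 1 ≠ 0 := by
      intro hX
      refine sq_ne_two_mul_sq hK h2 (a := X - 3) (b := 2) (Or.inr h20) ?_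
      linear_combination hX
    have h1 := sum_chi_two_binary_forms hK (c * X) (l ^ 2 * (1 + X ^ 2) - m * X) (c * X)
      (2 * b ^ 2) e (a ^ 2)
    -- With `w = X ^ 2 - 6 X + 1`, the identity `m + 2 c = 6 l ^ 2` makes the discriminant at `Y =
    -- 0` equal to `l ^ 2 w (l ^ 2 w + 4 c X)`. Replacing `Y` by `w Y` then lets the square `(l w) ^
    -- 2` split off.
    rw [← sum_comp_affine hw 0] at h1
    have h3 : ∀ Y : K, chi ((X ^ 2 - 6 * X + 1) * Y + 0)
          * chi ((l ^ 2 * (1 + X ^ 2) - m * X - ((X ^ 2 - 6 * X + 1) * Y + 0) * e) ^ 2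
          - 4 * (c * X - ((X ^ 2 - 6 * X + 1) * Y + 0) * (2 * b ^ 2))
            * (c * X - ((X ^ 2 - 6 * X + 1) * Y + 0) * a ^ 2))
        = chi (X ^ 2 - 6 * X + 1) * (chi Y
          * chi (Y ^ 2 - 2 * e * Y + (l ^ 2 + 4 * c * (X / (X ^ 2 - 6 * X + 1))))) := by
      intro Y
      rw [add_zero, chi_mul (X ^ 2 - 6 * X + 1), mul_assoc (chi (X ^ 2 - 6 * X + 1)),
        ← chi_sq_mul (mul_ne_zero hl0 hw) (Y ^ 2 - 2 * e * Y + _)]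
      congr 3
      have hr : X / (X ^ 2 - 6 * X + 1) * (X ^ 2 - 6 * X + 1) = X := div_mul_cancel₀ X hw
      generalize X / (X ^ 2 - 6 * X + 1) = r at hr ⊢
      rw [hl, hc, hm, he]
      linear_combination -4 * (a ^ 4 - 12 * a ^ 2 * b ^ 2 + 4 * b ^ 4) * (a ^ 2 - 2 * b ^ 2) ^ 2
        * (X ^ 2 - 6 * X + 1) * hr
    simp only [h3] at h1
    rw [← Finset.mul_sum] at h1
    have h5 : chi (X / (X ^ 2 - 6 * X + 1)) = chi X * chi (X ^ 2 - 6 * X + 1) := by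
      rw [← chi_mul, ← chi_sq_mul (inv_ne_zero hw) (X * _)]
      congr 1
      field_simp
    rw [h5, mul_assoc (chi X), ← mul_neg]
    unfold ellipticSum
    rw [← h1, Finset.mul_sum]
    refine Finset.sum_congr rfl fun v _ => ?_
    rw [show (2 * b ^ 2 * v.1 + a ^ 2 * v.2) * (v.1 + v.2)
      = 2 * b ^ 2 * v.1 ^ 2 + e * v.1 * v.2 + a ^ 2 * v.2 ^ 2 by rw [he]; ring]
    ring
  simp only [hX, Finset.sum_neg_distrib]
  rw [sum_ellipticSum_pencil hK h2, neg_zero]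
  rw [he, hl, hc]
  ring

end BranchSextic

open MvPolynomial

/-! ### Points of the double cover -/

section PointCount

variable {K : Type*} [Field K]

/-- The action of a nonzero scalar on the affine cone over the double cover. -/
def coneScale {f : MvPolynomial (Fin 3) K}
    (hf : ∀ (c : K) (v : Fin 3 → K), eval (fun i => c * v i) f = c ^ 6 * eval v f)
    (P : ConePoint f) (c : Kˣ) : ConePoint f :=
  ⟨(fun i => c * P.1.1 i, (c : K) ^ 3 * P.1.2), by
    obtain ⟨⟨v, w⟩, h0, h⟩ := P
    refine ⟨fun hP => h0 ?_, ?_⟩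
    · refine Prod.ext (funext fun i => ?_) ?_
      · exact (mul_eq_zero.mp (congrFun (congrArg Prod.fst hP) i)).resolve_left c.ne_zero
      · exact (mul_eq_zero.mp (congrArg Prod.snd hP)).resolve_left (pow_ne_zero 3 c.ne_zero)
    · dsimp only at h ⊢
      rw [hf, ← h]
      ring⟩

/-- The action is free because `(x, y, z) = 0` would force `w = 0`. -/
theorem coneScale_injective {f : MvPolynomial (Fin 3) K}
    (hf : ∀ (c : K) (v : Fin 3 → K), eval (fun i => c * v i) f = c ^ 6 * eval v f)
    (P : ConePoint f) : Function.Injective (coneScale hf P) := by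
  obtain ⟨⟨v, w⟩, h0, h⟩ := P
  intro c d hcd
  have hv : v ≠ 0 := by
    rintro rfl
    have h1 := hf 0 0
    simp only [Pi.zero_apply, mul_zero, ne_eq, OfNat.ofNat_ne_zero, not_false_eq_true, zero_pow,
      zero_mul] at h1
    refine h0 (Prod.ext rfl (pow_eq_zero_iff two_ne_zero |>.mp (h.trans h1)))
  obtain ⟨i, hi⟩ := Function.ne_iff.mp hv
  have h2 := congrFun (congrArg (fun P : ConePoint f => P.1.1) hcd) i
  exact Units.ext (mul_right_cancel₀ hi h2)

theorem card_doubleCover_mul {f : MvPolynomial (Fin 3) K}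
    (hf : ∀ (c : K) (v : Fin 3 → K), eval (fun i => c * v i) f = c ^ 6 * eval v f) :
    Nat.card (DoubleCover f) * Nat.card Kˣ = Nat.card (ConePoint f) := by
  have e : ∀ q : DoubleCover f, Kˣ ≃ {P : ConePoint f // Quotient.mk (coneSetoid f) P = q} := by
    intro q
    refine Equiv.ofBijective (fun c => ⟨coneScale hf (Quotient.out q) c, ?_⟩) ⟨?_, ?_⟩
    · conv_rhs => rw [← Quotient.out_eq q]
      exact Quotient.sound ((coneSetoid f).symm ⟨c, fun i => rfl, rfl⟩)
    · intro c d hcd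
      exact coneScale_injective hf _ (congrArg Subtype.val hcd)
    · rintro ⟨P, hP⟩
      rw [← Quotient.out_eq q] at hP
      obtain ⟨c, h1, h2⟩ := (coneSetoid f).symm (Quotient.exact hP)
      exact ⟨c, Subtype.ext (Subtype.ext (Prod.ext (funext fun i => (h1 i).symm) h2.symm))⟩
  rw [← Nat.card_prod]
  exact Nat.card_congr ((Equiv.sigmaEquivProd _ _).symm.trans
    ((Equiv.sigmaCongrRight e).trans (Equiv.sigmaFiberEquiv _)))

variable [Fintype K] [DecidableEq K]

theorem card_conePoint_cast (hK : ringChar K ≠ 2) {f : MvPolynomial (Fin 3) K}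
    (h0 : eval 0 f = 0) :
    (Nat.card (ConePoint f) : K) = ∑ v : Fin 3 → K, chi (eval v f) - 1 := by
  classical
  have h1 : Nat.card (ConePoint f)
      = (Finset.univ.filter fun P : (Fin 3 → K) × K => P ≠ 0 ∧ P.2 ^ 2 = eval P.1 f).card := by
    unfold ConePoint
    rw [Nat.card_eq_fintype_card, Fintype.card_subtype]
  have h2 : ∀ P : (Fin 3 → K) × K, (if P ≠ 0 ∧ P.2 ^ 2 = eval P.1 f then (1 : K) else 0)
      = (if P.2 ^ 2 = eval P.1 f then 1 else 0) - (if P = 0 then 1 else 0) := by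
    intro P
    by_cases hP : P = 0
    · subst hP
      -- The origin satisfies the equation, so excluding it subtracts exactly one.
      have h : (0 : (Fin 3 → K) × K).2 ^ 2 = eval (0 : (Fin 3 → K) × K).1 f :=
        (zero_pow two_ne_zero).trans h0.symm
      rw [if_neg fun h => h.1 rfl, if_pos h, if_pos rfl, sub_self]
    · simp [hP]
  rw [h1, ← Finset.sum_boole]
  simp only [h2, Finset.sum_sub_distrib]
  rw [Fintype.sum_prod_type]
  simp only [sum_ite_sq_eq hK, Finset.sum_add_distrib]
  simp [Finset.card_univ]

theorem card_doubleCover_cast (hK : ringChar K ≠ 2) {f : MvPolynomial (Fin 3) K}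
    (hf : ∀ (c : K) (v : Fin 3 → K), eval (fun i => c * v i) f = c ^ 6 * eval v f)
    (h : ∑ v : Fin 3 → K, chi (eval v f) = 0) : (Nat.card (DoubleCover f) : K) = 1 := by
  have h0 : eval 0 f = 0 := by
    have h1 := hf 0 0
    simpa [← Pi.zero_def] using h1
  have h1 := congrArg (Nat.cast : ℕ → K) (card_doubleCover_mul hf)
  rw [card_conePoint_cast hK h0, h, Nat.cast_mul, Nat.card_eq_fintype_card (α := Kˣ), Fintype.card_units,
    Nat.cast_sub Fintype.card_pos, Nat.cast_card_eq_zero] at h1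
  push_cast at h1
  linear_combination -h1

end PointCount

/-! ### Models primitive at `p` -/

section Model

/-- The branch sextic for `t = a / b`, cleared of denominators. -/
noncomputable def sexticForm {R : Type*} [CommRing R] (a b : R) : MvPolynomial (Fin 3) R :=
  sexticValue (C a) (C b) (X 0) (X 1) (X 2)

theorem eval_sexticForm {R : Type*} [CommRing R] (a b : R) (v : Fin 3 → R) :
    eval v (sexticForm a b) = sexticValue a b (v 0) (v 1) (v 2) := by
  simp [sexticForm, sexticValue]

theorem map_sexticForm {R S : Type*} [CommRing R] [CommRing S] (g : R →+* S) (a b : R) :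
    map g (sexticForm a b) = sexticForm (g a) (g b) := by
  simp [sexticForm, sexticValue]

theorem sexticForm_div (a : ℚ) {b : ℚ} (hb : b ≠ 0) :
    sexticForm a b = C ((8 * b ^ 3) ^ 2) * branchSextic (a / b) := by
  refine MvPolynomial.funext fun v => ?_
  rw [eval_sexticForm]
  simp only [sexticValue, branchSextic, q₁, q₂, q₃, map_mul, map_add, map_pow, eval_C, eval_X]
  field_simp
  ring

variable {K : Type*} [Field K] [Fintype K] [DecidableEq K]

theorem sexticForm_ne_zero (hK : ringChar K ≠ 2) (h2 : chi (2 : K) = -1) {a b : K}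
    (hab : a ≠ 0 ∨ b ≠ 0) : sexticForm a b ≠ 0 := by
  have h20 : (2 : K) ≠ 0 := Ring.two_ne_zero hK
  have h8 : (8 : K) ≠ 0 := by
    rw [show (8 : K) = 2 ^ 3 by norm_num]
    exact pow_ne_zero 3 h20
  -- For `e = ±2` the form is `(a + e b) ^ 2 - 2 b ^ 2`, hence anisotropic.
  have hA : ∀ e : K, e ^ 2 = 4 → a ^ 2 + 2 * e * a * b + 2 * b ^ 2 ≠ 0 := by
    intro e he h
    refine sq_ne_two_mul_sq hK h2 (a := a + e * b) (b := b) ?_ ?_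
    · by_cases hb : b = 0
      · simp_all
      · exact Or.inr hb
    · linear_combination h + b ^ 2 * he
  have hA1 := hA (-2) (by norm_num)
  have hA2 := hA 2 (by norm_num)
  unfold sexticForm sexticValue
  refine mul_ne_zero (mul_ne_zero ?_ ?_) ?_
  · intro h
    have := congrArg (eval ![0, 0, 1]) h
    simp [h8] at this
    exact hA1 (by linear_combination this)
  · intro h
    have := congrArg (eval ![0, 0, 1]) h
    simp [h8] at this
    exact hA2 (by linear_combination this)
  · intro h
    have h3 := congrArg (eval ![1, 0, 0]) h
    have h4 := congrArg (eval ![0, 1, 0]) h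
    simp [h20] at h3 h4
    simp_all

theorem sum_chi_eval_sexticForm (hK : ringChar K ≠ 2) (h2 : chi (2 : K) = -1) {a b : K}
    (hab : a ≠ 0 ∨ b ≠ 0) : ∑ v : Fin 3 → K, chi (eval v (sexticForm a b)) = 0 := by
  let e : (Fin 3 → K) ≃ (K × K) × K :=
    { toFun := fun v => ((v 0, v 1), v 2)
      invFun := fun P => ![P.1.1, P.1.2, P.2]
      left_inv := fun v => by ext i; fin_cases i <;> rfl
      right_inv := fun P => rfl }
  rw [← sum_chi_sexticValue hK h2 hab, ← Fintype.sum_prod_type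
    (f := fun P : (K × K) × K => chi (sexticValue a b P.1.1 P.1.2 P.2))]
  exact Fintype.sum_equiv e _ _ fun v => by
    rw [eval_sexticForm]
    rfl

end Model

theorem chi_two_eq_neg_one {p : ℕ} [Fact p.Prime] (hp : p % 8 = 3 ∨ p % 8 = 5) :
    chi (2 : ZMod p) = -1 := by
  have hK : ringChar (ZMod p) ≠ 2 := by
    rw [ZMod.ringChar_zmod_n]
    omega
  unfold chi
  rw [quadraticChar_two hK, ZMod.card, ZMod.χ₈_nat_eq_if_mod_eight, if_neg (by omega),
    if_neg (by omega)]
  simp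

theorem intCast_num_or_den_ne_zero (p : ℕ) [Fact p.Prime] (r : ℚ) :
    ((r.num : ℤ) : ZMod p) ≠ 0 ∨ ((r.den : ℤ) : ZMod p) ≠ 0 := by
  by_contra! h
  rw [ZMod.intCast_zmod_eq_zero_iff_dvd, ZMod.intCast_zmod_eq_zero_iff_dvd] at h
  have h1 := Nat.dvd_gcd (Int.natCast_dvd.mp h.1) (Int.natCast_dvd_natCast.mp h.2)
  rw [r.reduced] at h1
  exact (Fact.out : p.Prime).one_lt.ne' (Nat.dvd_one.mp h1)

theorem map_sexticForm_rat (t : ℚ) :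
    map (Int.castRingHom ℚ) (sexticForm t.num (t.den : ℤ))
      = C ((8 * (t.den : ℚ) ^ 3) ^ 2) * branchSextic t := by
  rw [map_sexticForm]
  have h := sexticForm_div (t.num : ℚ) (Nat.cast_ne_zero.mpr t.den_nz : (t.den : ℚ) ≠ 0)
  rw [Rat.num_div_den] at h
  simpa using h

/-- Modulo `p`, two models of the branch sextic differ by the square of a nonzero constant. -/
theorem IsModelAt.exists_map_eq {p : ℕ} [Fact p.Prime] {f : MvPolynomial (Fin 3) ℚ}
    {F G : MvPolynomial (Fin 3) ℤ} (hF : IsModelAt p f F) (hG : IsModelAt p f G) :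
    ∃ k : ZMod p, k ≠ 0 ∧ map (Int.castRingHom (ZMod p)) F
      = C (k ^ 2) * map (Int.castRingHom (ZMod p)) G := by
  obtain ⟨⟨c, hc, hcF⟩, hF0⟩ := hF
  obtain ⟨⟨d, hd, hdG⟩, hG0⟩ := hG
  have hZ : C ((((c / d).den : ℤ)) ^ 2) * F = C ((c / d).num ^ 2) * G := by
    apply map_injective (Int.castRingHom ℚ) Int.cast_injective
    rw [map_mul, map_mul, map_C, map_C, hcF, hdG, ← mul_assoc, ← mul_assoc, ← C_mul, ← C_mul]
    congr 2
    have h1 : ((c / d).den : ℚ) * c = (c / d).num * d := by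
      have h2 := Rat.den_mul_eq_num (c / d)
      rw [← h2]
      field_simp
    simp only [map_pow, eq_intCast, Int.cast_natCast]
    rw [← mul_pow, h1, mul_pow]
  have hp := congrArg (map (Int.castRingHom (ZMod p))) hZ
  rw [map_mul, map_mul, map_C, map_C, eq_intCast (Int.castRingHom (ZMod p)),
    eq_intCast (Int.castRingHom (ZMod p)), Int.cast_pow, Int.cast_pow] at hp
  have hor := intCast_num_or_den_ne_zero p (c / d)
  set n : ZMod p := ((c / d).num : ZMod p)
  set m : ZMod p := (((c / d).den : ℤ) : ZMod p)
  -- Modulo `p`, `m ^ 2 F = n ^ 2 G` with `F`, `G` nonzero and `n`, `m` not both zero; so neither is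
  -- zero.
  have hm : m ≠ 0 := by
    intro hm
    rw [hm, zero_pow two_ne_zero, C_0, zero_mul, eq_comm, mul_eq_zero, or_iff_left hG0,
      C_eq_zero] at hp
    exact hor.elim (fun h => h (pow_eq_zero_iff two_ne_zero |>.mp hp)) fun h => h hm
  have hn : n ≠ 0 := by
    intro hn
    rw [hn, zero_pow two_ne_zero, C_0, zero_mul, mul_eq_zero, or_iff_left hF0, C_eq_zero] at hp
    exact hm (pow_eq_zero_iff two_ne_zero |>.mp hp)
  refine ⟨n / m, div_ne_zero hn hm, ?_⟩
  rw [show (n / m) ^ 2 = (m ^ 2)⁻¹ * n ^ 2 by field_simp, C_mul, mul_assoc, ← hp, ← mul_assoc,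
    ← C_mul, inv_mul_cancel₀ (pow_ne_zero 2 hm), C_1, one_mul]

theorem isModelAt_sexticForm {p : ℕ} [Fact p.Prime] (hp : p % 8 = 3 ∨ p % 8 = 5) (t : ℚ) :
    IsModelAt p (branchSextic t) (sexticForm t.num (t.den : ℤ)) := by
  have hK : ringChar (ZMod p) ≠ 2 := by
    rw [ZMod.ringChar_zmod_n]
    omega
  refine ⟨⟨8 * (t.den : ℚ) ^ 3, by have := t.den_nz; positivity, map_sexticForm_rat t⟩, ?_⟩
  rw [map_sexticForm]
  exact sexticForm_ne_zero hK (chi_two_eq_neg_one hp) (intCast_num_or_den_ne_zero p t)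

end RealMult

theorem mainTheorem3 (t : ℚ) (p : ℕ) [Fact p.Prime] (hp : p % 8 = 3 ∨ p % 8 = 5) :
    (∃ F : MvPolynomial (Fin 3) ℤ, RealMult.IsModelAt p (RealMult.branchSextic t) F) ∧
      ∀ F : MvPolynomial (Fin 3) ℤ, RealMult.IsModelAt p (RealMult.branchSextic t) F →
        Nat.card (RealMult.DoubleCover (MvPolynomial.map (Int.castRingHom (ZMod p)) F)) ≡ 1
          [MOD p] := by
  have hG := RealMult.isModelAt_sexticForm hp t
  refine ⟨⟨_, hG⟩, fun F hF => ?_⟩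
  have hK : ringChar (ZMod p) ≠ 2 := by
    rw [ZMod.ringChar_zmod_n]
    omega
  obtain ⟨k, hk, hFG⟩ := hF.exists_map_eq hG
  rw [RealMult.map_sexticForm] at hFG
  rw [← ZMod.natCast_eq_natCast_iff, Nat.cast_one, hFG]
  refine RealMult.card_doubleCover_cast hK (fun c v => ?_) ?_
  · simp only [map_mul, MvPolynomial.eval_C, RealMult.eval_sexticForm, RealMult.sexticValue]
    ring
  · simp only [map_mul, MvPolynomial.eval_C, RealMult.chi_sq_mul hk]
    exact RealMult.sum_chi_eval_sexticForm hK (RealMult.chi_two_eq_neg_one hp)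
      (RealMult.intCast_num_or_den_ne_zero p t)
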